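/- All monoids are commutative and written additively; all rings are associative and need not be unital. A monoid $M$ is conical if $x+y=0$ implies $x=y=0$. It is a refinement monoid if whenever $x_1+x_2=y_1+y_2$ in $M$ there are $z_{ij}\in M$ ($1\le i,j\le 2$) with $x_i=z_{i1}+z_{i2}$ and $y_j=z_{1j}+z_{2j}$ for all $i,j$. An order-unit of $M$ is an element $u$ such that for every $x\in M$ there are $y\in M$ and $n\ge 1$ with $x+y=nu$. An order-ideal of $M$ is a submonoid $I$ such that $x+z\in I$ implies $x\in I$, for all $x,z\in M$; the quotient $M/I$ is the quotient of $M$ by the congruence $x\equiv_I y\iff x+a=y+b$ for some $a,b\in I$. A monoid is simplicial if it is isomorphic to $(\mathbb Z^+)^k$ for some positive integer $k$, where $\mathbb Z^+=\{0,1,2,\dots\}$. A ring $R$ is von Neumann regular if for every $a\in R$ there is $x\in R$ with $axa=a$. For a unital ring $R$, $\mathcal V(R)$ is the monoid of isomorphism classes of finitely generated projective right $R$-modules, with $[P]+[Q]=[P\oplus Q]$. For an algebra $R$ over a field $F$ that is not assumed to have a unit, $\mathcal V(R)$ is the submonoid of $\mathcal V(F\oplus R)$ that consists of the classes $[P]$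 with $P=PR$, where $F\oplus R$ is the unitization of $R$, which contains $R$ as a two-sided ideal. **Proposition (Wehrung).** Let $M$ be a conical refinement monoid with an order-unit $u$. Suppose that there is a sequence $(I_n)_{n\in\mathbb N}$ of order-ideals of $M$ such that $\bigcap_n I_n=\{0\}$ and $M/I_n$ is simplicial for every $n$, and suppose that $M$ is not cancellative. Let $F$ be an uncountable field. Then there is no von Neumann regular $F$-algebra $R$, unital or not, such that $\mathcal V(R)\cong M$. -/

import Mathlib

universe u v w

/-! ### Commutative monoids, written additively -/

/-- A commutative monoid is conical if `x + y = 0` implies `x = y = 0`. -/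
def IsConical (M : Type u) [AddCommMonoid M] : Prop :=
  ∀ x y : M, x + y = 0 → x = 0 ∧ y = 0

/-- A commutative monoid is a refinement monoid if every equality `x₁ + x₂ = y₁ + y₂`
has a refinement. -/
def IsRefinementMonoid (M : Type u) [AddCommMonoid M] : Prop :=
  ∀ x₁ x₂ y₁ y₂ : M, x₁ + x₂ = y₁ + y₂ →
    ∃ z₁₁ z₁₂ z₂₁ z₂₂ : M,
      x₁ = z₁₁ + z₁₂ ∧ x₂ = z₂₁ + z₂₂ ∧ y₁ = z₁₁ + z₂₁ ∧ y₂ = z₁₂ + z₂₂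

/-- `e` is an order-unit: every `x` satisfies `x + y = n • e` for some `y` and some `n ≥ 1`. -/
def IsOrderUnit {M : Type u} [AddCommMonoid M] (e : M) : Prop :=
  ∀ x : M, ∃ (y : M) (n : ℕ), 1 ≤ n ∧ x + y = n • e

/-- A submonoid `I` is an order-ideal if it is closed downwards in the algebraic preorder,
where `x ≤ y` means `y = x + z` for some `z`. -/
def IsOrderIdeal {M : Type u} [AddCommMonoid M] (I : AddSubmonoid M) : Prop :=
  ∀ x y : M, (∃ z : M, y = x + z) → y ∈ I → x ∈ I

/-- The congruence `x ≡ y` iff `x + a = y + b` for some `a, b ∈ I`. -/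
def idealCon {M : Type u} [AddCommMonoid M] (I : AddSubmonoid M) : AddCon M where
  r x y := ∃ a ∈ I, ∃ b ∈ I, x + a = y + b
  iseqv :=
    { refl := fun _ => ⟨0, I.zero_mem, 0, I.zero_mem, rfl⟩
      symm := fun ⟨a, ha, b, hb, h⟩ => ⟨b, hb, a, ha, h.symm⟩
      trans := by
        rintro x y z ⟨a, ha, b, hb, h⟩ ⟨c, hc, d, hd, h'⟩
        refine ⟨a + c, I.add_mem ha hc, d + b, I.add_mem hd hb, ?_⟩
        rw [← add_assoc, h, ← add_assoc, ← h', add_right_comm] }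
  add' := by
    rintro x y z t ⟨a, ha, b, hb, h⟩ ⟨c, hc, d, hd, h'⟩
    refine ⟨a + c, I.add_mem ha hc, b + d, I.add_mem hb hd, ?_⟩
    rw [add_add_add_comm, h, h', add_add_add_comm]

/-- The ideal quotient `M / I`. -/
abbrev IdealQuotient {M : Type u} [AddCommMonoid M] (I : AddSubmonoid M) : Type u :=
  (idealCon I).Quotient

/-- A simplicial monoid is a monoid isomorphic to `ℕ ^ k` for some positive integer `k`. -/
def IsSimplicialMonoid (M : Type u) [AddCommMonoid M] : Prop :=
  ∃ k : ℕ, 0 < k ∧ Nonempty (M ≃+ (Fin k → ℕ))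

/-! ### Von Neumann regular rings -/

/-- A ring, unital or not, is von Neumann regular if every `a` has the form `a * x * a`. -/
def IsVonNeumannRegular (R : Type u) [NonUnitalRing R] : Prop :=
  ∀ a : R, ∃ x : R, a * x * a = a

/-! ### The monoid of isomorphism classes of finitely generated projective right modules -/

/-- A finitely generated projective right module over a unital ring `R`. Right `R`-modules are
modules over the opposite ring `Rᵐᵒᵖ`. -/
structure FGProjModule (R : Type u) [Ring R] where
  carrier : Type u
  [addCommGroup : AddCommGroup carrier]
  [module : Module Rᵐᵒᵖ carrier]
  [finite : Module.Finite Rᵐᵒᵖ carrier]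
  [projective : Module.Projective Rᵐᵒᵖ carrier]

namespace FGProjModule

attribute [instance] addCommGroup module finite projective

/-- Two modules are identified when they are isomorphic. -/
instance setoid (R : Type u) [Ring R] : Setoid (FGProjModule R) where
  r P Q := Nonempty (P.carrier ≃ₗ[Rᵐᵒᵖ] Q.carrier)
  iseqv :=
    { refl := fun P => ⟨LinearEquiv.refl Rᵐᵒᵖ P.carrier⟩
      symm := fun ⟨f⟩ => ⟨f.symm⟩
      trans := fun ⟨f⟩ ⟨g⟩ => ⟨f.trans g⟩ }

/-- The zero module. -/
def zero (R : Type u) [Ring R] : FGProjModule R where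
  carrier := PUnit.{u + 1}

/-- The direct sum of two modules. -/
def directSum {R : Type u} [Ring R] (P Q : FGProjModule R) : FGProjModule R where
  carrier := P.carrier × Q.carrier

/-- `P = P J`, where `P J` is generated by the elements `p j` with `p ∈ P` and `j ∈ J`. -/
def EqMulIdeal {R : Type u} [Ring R] (P : FGProjModule R) (J : TwoSidedIdeal R) : Prop :=
  Submodule.span Rᵐᵒᵖ {x : P.carrier | ∃ (p : P.carrier) (j : R), j ∈ J ∧
    x = MulOpposite.op j • p} = ⊤

theorem eqMulIdeal_zero {R : Type u} [Ring R] (J : TwoSidedIdeal R) :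
    (zero R).EqMulIdeal J := by
  refine eq_top_iff.2 fun x _ => ?_
  have hx : x = 0 := Subsingleton.elim (α := PUnit.{u + 1}) _ _
  rw [hx]
  exact Submodule.zero_mem _

theorem eqMulIdeal_directSum {R : Type u} [Ring R] {P Q : FGProjModule R} {J : TwoSidedIdeal R}
    (hP : P.EqMulIdeal J) (hQ : Q.EqMulIdeal J) : (P.directSum Q).EqMulIdeal J := by
  unfold EqMulIdeal at hP hQ ⊢
  refine eq_top_iff.2 fun x _ => ?_
  set N : Submodule Rᵐᵒᵖ (P.carrier × Q.carrier) :=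
    Submodule.span Rᵐᵒᵖ {x : P.carrier × Q.carrier | ∃ (p : P.carrier × Q.carrier) (j : R),
      j ∈ J ∧ x = MulOpposite.op j • p} with hN
  have h₁ : (⊤ : Submodule Rᵐᵒᵖ P.carrier) ≤ N.comap (LinearMap.inl Rᵐᵒᵖ _ _) := by
    rw [← hP, Submodule.span_le]
    rintro _ ⟨p, j, hj, rfl⟩
    exact Submodule.subset_span ⟨(p, 0), j, hj, by simp⟩
  have h₂ : (⊤ : Submodule Rᵐᵒᵖ Q.carrier) ≤ N.comap (LinearMap.inr Rᵐᵒᵖ _ _) := by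
    rw [← hQ, Submodule.span_le]
    rintro _ ⟨p, j, hj, rfl⟩
    exact Submodule.subset_span ⟨(0, p), j, hj, by simp⟩
  have h := N.add_mem (h₁ (x := x.1) trivial) (h₂ (x := x.2) trivial)
  have hx : LinearMap.inl Rᵐᵒᵖ _ _ x.1 + LinearMap.inr Rᵐᵒᵖ _ _ x.2 = x := by
    change ((x.1 + 0, 0 + x.2) : P.carrier × Q.carrier) = (x.1, x.2)
    rw [add_zero, zero_add]
  exact hx ▸ h

end FGProjModule

/-- `V R`: the isomorphism classes of finitely generated projective right modules over the
unital ring `R`. -/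
def V (R : Type u) [Ring R] : Type (u + 1) :=
  Quotient (FGProjModule.setoid R)

namespace V

/-- The isomorphism class `[P]`. -/
def mk {R : Type u} [Ring R] (P : FGProjModule R) : V R :=
  Quotient.mk (FGProjModule.setoid R) P

theorem mk_eq_mk {R : Type u} [Ring R] {P Q : FGProjModule R} :
    mk P = mk Q ↔ Nonempty (P.carrier ≃ₗ[Rᵐᵒᵖ] Q.carrier) :=
  Quotient.eq

instance instZero (R : Type u) [Ring R] : Zero (V R) where
  zero := mk (FGProjModule.zero R)

/-- The sum is `[P] + [Q] = [P ⊕ Q]`. -/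
instance instAdd (R : Type u) [Ring R] : Add (V R) where
  add := Quotient.map₂ FGProjModule.directSum
    (fun _ _ ⟨f⟩ _ _ ⟨g⟩ => ⟨LinearEquiv.prodCongr f g⟩)

instance addCommMonoid (R : Type u) [Ring R] : AddCommMonoid (V R) where
  add_assoc := by
    rintro ⟨P⟩ ⟨Q⟩ ⟨T⟩
    exact mk_eq_mk.2 ⟨LinearEquiv.prodAssoc Rᵐᵒᵖ P.carrier Q.carrier T.carrier⟩
  add_comm := by
    rintro ⟨P⟩ ⟨Q⟩
    exact mk_eq_mk.2 ⟨LinearEquiv.prodComm Rᵐᵒᵖ P.carrier Q.carrier⟩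
  zero_add := by
    rintro ⟨P⟩
    exact mk_eq_mk.2 ⟨LinearEquiv.uniqueProd (R := Rᵐᵒᵖ) (M := P.carrier) (M₂ := PUnit.{u + 1})⟩
  add_zero := by
    rintro ⟨P⟩
    exact mk_eq_mk.2 ⟨LinearEquiv.prodUnique (R := Rᵐᵒᵖ) (M := P.carrier) (M₂ := PUnit.{u + 1})⟩
  nsmul := nsmulRec

theorem zero_def (R : Type u) [Ring R] : (0 : V R) = mk (FGProjModule.zero R) := rfl

theorem mk_add_mk {R : Type u} [Ring R] (P Q : FGProjModule R) :
    mk P + mk Q = mk (P.directSum Q) := rfl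

/-- For a two-sided ideal `J` of a unital ring `R`, the submonoid
`V(J) = {[P] ∈ V(R) | P = P J}` of `V(R)`. -/
def ofIdeal {R : Type u} [Ring R] (J : TwoSidedIdeal R) : AddSubmonoid (V R) where
  carrier := {x | ∃ P : FGProjModule R, P.EqMulIdeal J ∧ x = mk P}
  zero_mem' := ⟨_, FGProjModule.eqMulIdeal_zero J, rfl⟩
  add_mem' := by
    rintro _ _ ⟨P, hP, rfl⟩ ⟨Q, hQ, rfl⟩
    exact ⟨_, FGProjModule.eqMulIdeal_directSum hP hQ, rfl⟩

end V

/-- The monoid `V(R)` of a possibly non-unital algebra `R` over a field `F`: it is `V(J)` for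
the ideal `J = R` of the unitization `F ⊕ R`, that is, for the kernel of the projection
`F ⊕ R → F`. -/
def nonunitalV (F : Type v) (R : Type w) [Field F] [NonUnitalRing R] [Module F R]
    [IsScalarTower F R R] [SMulCommClass F R R] : AddSubmonoid (V (Unitization F R)) :=
  V.ofIdeal (TwoSidedIdeal.ker (Unitization.fstHom F R))

/-!
The hypotheses on `M` are used only through countably many homomorphisms `M → ℕ` that together
vanish at `0` alone: the simplicial quotients `M / I n` followed by the sum of the coordinates
(`exists_addMonoidHom_of_isSimplicialMonoid`). In the unital case as in the non-unital one, `M` is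
then isomorphic to a submonoid `N` of `V T`, closed downwards, where `T` is a unital regular
algebra over the uncountable field `F`: the unitization of a regular algebra is regular, and the
classes `[P]` with `P = P J` are closed downwards. It remains to see that such an `N` is
cancellative (`isCancelAdd_of_faithful`).

Over a regular ring, finitely generated submodules of finitely generated projective modules are
direct summands. So, for `[P] ∈ N` and an endomorphism `f` of `P`, the eigenspaces
`ker (f - c)`, `c ∈ F`, have classes in `N`. They are independent, so each homomorphism `N → ℕ` is
nonzero at only finitely many of these classes, and `f - c` is injective for all but countably
many `c`. An injective endomorphism of `P` is surjective, since `[P] = [P] + [coker]` forces every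
homomorphism `N → ℕ` to vanish at `[coker]`. Thus `f - c` is invertible for all but countably many
`c` (`countable_setOf_not_bijective`).

Let now `e : A ⊕ B ≅ A ⊕ C`, with all classes in `N`. On `P = A ⊕ B` let `f` map `A` onto its other
copy `e⁻¹ A` and kill `B`, and let `x` map `e⁻¹ A` back onto `A` and kill `e⁻¹ C`. As `F` is
uncountable, there is `c ≠ 0` such that `f - c` and `x - c⁻¹` are both invertible. On `A` one has
`f - c = (1 - c x) f`, so the automorphism `(1 - c x)⁻¹ (f - c)` of `P` extends the isomorphism
`A ≅ e⁻¹ A`, and hence `B ≅ P / A ≅ P / e⁻¹ A ≅ C` (`nonempty_equiv_of_bijective`).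
-/

/-! ### Finitely generated projective modules over regular rings -/

/-- Every element `x` of the module is fixed by a scalar `φ x` with `φ` a linear functional
(a regular module in the sense of Zelmanowitz). Over a von Neumann regular ring, free modules of
finite rank have this property, and it passes to submodules. -/
def IsRegularModule (S : Type u) (N : Type v) [Ring S] [AddCommGroup N] [Module S N] : Prop :=
  ∀ x : N, ∃ φ : N →ₗ[S] S, φ x • x = x

theorem IsRegularModule.of_injective {S : Type u} {N : Type v} {N' : Type w} [Ring S]
    [AddCommGroup N] [Module S N] [AddCommGroup N'] [Module S N'] (hN : IsRegularModule S N)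
    (i : N' →ₗ[S] N) (hi : Function.Injective i) : IsRegularModule S N' := by
  intro x
  obtain ⟨φ, hφ⟩ := hN (i x)
  exact ⟨φ.comp i, hi (by simpa using hφ)⟩

theorem IsRegularModule.prod {S : Type u} {N : Type v} {N' : Type w} [Ring S]
    [AddCommGroup N] [Module S N] [AddCommGroup N'] [Module S N'] (hN : IsRegularModule S N)
    (hN' : IsRegularModule S N') : IsRegularModule S (N × N') := by
  rintro ⟨x, y⟩
  obtain ⟨φ, hφ⟩ := hN x
  -- `ψ` handles the part `y - φ x • y` of the second component that `φ x` does not fix.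
  obtain ⟨ψ, hψ⟩ := hN' (y - φ x • y)
  refine ⟨φ.comp (LinearMap.fst S N N') + (LinearMap.toSpanSingleton S S (1 - φ x)).comp
    (ψ.comp (LinearMap.snd S N N') -
      (LinearMap.toSpanSingleton S S (ψ y)).comp (φ.comp (LinearMap.fst S N N'))), ?_⟩
  have key : ∀ (Z : Type (max v w)) [AddCommGroup Z] [Module S Z] (z : Z),
      (φ x + (ψ y - φ x * ψ y) * (1 - φ x)) • z =
        φ x • z + ψ (y - φ x • y) • (z - φ x • z) := by
    intro Z _ _ z
    rw [map_sub, map_smul, smul_eq_mul, add_smul, mul_smul, sub_smul, sub_smul 1, one_smul,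
      sub_smul]
  simp only [LinearMap.add_apply, LinearMap.comp_apply, LinearMap.fst_apply, LinearMap.sub_apply,
    LinearMap.snd_apply, LinearMap.toSpanSingleton_apply, smul_eq_mul]
  rw [key]
  ext
  · simp [hφ]
  · rw [map_sub, map_smul, smul_eq_mul] at hψ
    simp [hψ]

theorem IsRegularModule.finFun {S : Type u} [Ring S] (hS : IsVonNeumannRegular S) (n : ℕ) :
    IsRegularModule S (Fin n → S) := by
  induction n with
  | zero => exact fun x => ⟨0, Subsingleton.elim _ _⟩
  | succ n ih =>
    have hS' : IsRegularModule S S := by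
      intro a
      obtain ⟨x, hx⟩ := hS a
      exact ⟨LinearMap.toSpanSingleton S S x, by simpa using hx⟩
    refine (hS'.prod ih).of_injective
      (LinearMap.prod (LinearMap.proj 0) (LinearMap.funLeft S S Fin.succ)) ?_
    intro x y hxy
    have h := Prod.ext_iff.1 hxy
    ext i
    refine Fin.cases h.1 (fun j => congrFun h.2 j) i

theorem isRegularModule_of_projective {S : Type u} {P : Type v} [Ring S]
    (hS : IsVonNeumannRegular S) [AddCommGroup P] [Module S P] [Module.Finite S P]
    [Module.Projective S P] : IsRegularModule S P := by
  obtain ⟨n, f, hf⟩ := Module.Finite.exists_fin' S P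
  obtain ⟨g, hg⟩ := Module.projective_lifting_property f LinearMap.id hf
  exact (IsRegularModule.finFun hS n).of_injective g
    (Function.LeftInverse.injective (g := f) fun x => LinearMap.congr_fun hg x)

theorem IsRegularModule.exists_retraction {S : Type u} {N : Type v} [Ring S]
    [AddCommGroup N] [Module S N] (hN : IsRegularModule S N) (K : Submodule S N) (hK : K.FG) :
    ∃ p : N →ₗ[S] K, ∀ x : K, p x = x := by
  suffices h : ∃ p : N →ₗ[S] N, (∀ x, p x ∈ K) ∧ ∀ x ∈ K, p x = x by
    obtain ⟨p, h₁, h₂⟩ := h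
    exact ⟨p.codRestrict K h₁, fun x => Subtype.ext (h₂ x x.2)⟩
  obtain ⟨s, hs, rfl⟩ := Submodule.fg_def.1 hK
  clear hK
  induction s, hs using Set.Finite.induction_on with
  | empty => exact ⟨0, by simp, by simp +contextual⟩
  | @insert x s _ _ ih =>
    obtain ⟨p, h₁, h₂⟩ := ih
    have hmono : Submodule.span S s ≤ Submodule.span S (insert x s) :=
      Submodule.span_mono (Set.subset_insert x s)
    have hx : x ∈ Submodule.span S (insert x s) := Submodule.subset_span (Set.mem_insert x s)
    obtain ⟨φ, hφ⟩ := hN (x - p x)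
    refine ⟨p + (LinearMap.toSpanSingleton S N (x - p x)).comp (φ.comp (LinearMap.id - p)),
      fun y => ?_, fun y hy => ?_⟩
    · exact Submodule.add_mem _ (hmono (h₁ y))
        (Submodule.smul_mem _ _ (Submodule.sub_mem _ hx (hmono (h₁ x))))
    · induction hy using Submodule.span_induction with
      | mem y hy =>
        rcases hy with rfl | hy
        · simp only [LinearMap.add_apply, LinearMap.comp_apply, LinearMap.sub_apply,
            LinearMap.id_apply, LinearMap.toSpanSingleton_apply]
          rw [hφ]
          abel
        · simp [h₂ y (Submodule.subset_span hy)]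
      | zero => simp
      | add y z _ _ hy hz => rw [map_add, hy, hz]
      | smul a y _ hy => rw [map_smul, hy]

section Regular

variable {S : Type u} {P : Type v} {Q : Type w} [Ring S]
  [AddCommGroup P] [Module S P] [Module.Finite S P] [Module.Projective S P]
  [AddCommGroup Q] [Module S Q] [Module.Finite S Q] [Module.Projective S Q]

theorem projective_of_fg (hS : IsVonNeumannRegular S) {K : Submodule S P} (hK : K.FG) :
    Module.Projective S K := by
  obtain ⟨p, hp⟩ := (isRegularModule_of_projective hS).exists_retraction K hK
  exact Module.Projective.of_split K.subtype p (LinearMap.ext hp)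

omit [Module.Projective S P] in
theorem fg_ker (hS : IsVonNeumannRegular S) (f : P →ₗ[S] Q) : (LinearMap.ker f).FG := by
  have hfg : (LinearMap.range f).FG := Submodule.fg_range f
  have := projective_of_fg hS hfg
  have := Module.Finite.of_fg hfg
  have := Module.finitePresentation_of_projective S (LinearMap.range f)
  have h := Module.FinitePresentation.fg_ker f.rangeRestrict f.surjective_rangeRestrict
  rwa [LinearMap.ker_rangeRestrict] at h

end Regular

theorem IsVonNeumannRegular.mulOpposite {T : Type u} [Ring T] (hT : IsVonNeumannRegular T) :
    IsVonNeumannRegular Tᵐᵒᵖ := by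
  intro a
  obtain ⟨x, hx⟩ := hT a.unop
  refine ⟨MulOpposite.op x, MulOpposite.unop_injective ?_⟩
  simpa [mul_assoc] using hx

/-! ### Submodules and their classes -/

/-- A finitely generated submodule of a finitely generated projective module over a regular
ring, as a finitely generated projective module. -/
def FGProjModule.ofFG {T : Type u} [Ring T] (hT : IsVonNeumannRegular T) (P : FGProjModule T)
    (K : Submodule Tᵐᵒᵖ P.carrier) (hK : K.FG) : FGProjModule T :=
  have := Module.Finite.of_fg hK
  have := projective_of_fg hT.mulOpposite hK
  ⟨K⟩

section Classes

variable {T : Type u} [Ring T] (hT : IsVonNeumannRegular T) (P : FGProjModule T)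

theorem V.mk_eq_zero_iff {Q : FGProjModule T} : V.mk Q = 0 ↔ Subsingleton Q.carrier := by
  rw [V.zero_def, V.mk_eq_mk]
  constructor
  · rintro ⟨f⟩
    exact Equiv.subsingleton (β := PUnit.{u + 1}) f.toEquiv
  · intro h
    exact ⟨(0 : Q.carrier ≃ₗ[Tᵐᵒᵖ] PUnit.{u + 1})⟩

theorem V.mk_ofFG_eq_zero_iff {K : Submodule Tᵐᵒᵖ P.carrier} (hK : K.FG) :
    V.mk (P.ofFG hT K hK) = 0 ↔ K = ⊥ :=
  V.mk_eq_zero_iff.trans Submodule.subsingleton_iff_eq_bot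

theorem V.exists_isCompl {K : Submodule Tᵐᵒᵖ P.carrier} (hK : K.FG) :
    ∃ (C : Submodule Tᵐᵒᵖ P.carrier) (hC : C.FG), IsCompl K C ∧
      V.mk (P.ofFG hT K hK) + V.mk (P.ofFG hT C hC) = V.mk P := by
  have := Module.Finite.of_fg hK
  have := projective_of_fg hT.mulOpposite hK
  obtain ⟨p, hp⟩ :=
    (isRegularModule_of_projective hT.mulOpposite).exists_retraction K hK
  have hC := LinearMap.isCompl_of_proj hp
  exact ⟨LinearMap.ker p, fg_ker hT.mulOpposite p, hC,
    V.mk_eq_mk.2 ⟨Submodule.prodEquivOfIsCompl K _ hC⟩⟩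

theorem V.mk_ofFG_add_mk_ofFG {K L : Submodule Tᵐᵒᵖ P.carrier} (hK : K.FG) (hL : L.FG)
    (hKL : Disjoint K L) :
    V.mk (P.ofFG hT K hK) + V.mk (P.ofFG hT L hL) = V.mk (P.ofFG hT (K ⊔ L) (hK.sup hL)) := by
  have hinj : Function.Injective (K.subtype.coprod L.subtype) := by
    rw [← LinearMap.ker_eq_bot, LinearMap.ker_coprod_of_disjoint_range _ _ (by simpa using hKL)]
    simp
  refine V.mk_eq_mk.2 ⟨(LinearEquiv.ofInjective _ hinj).trans (LinearEquiv.ofEq _ _ ?_)⟩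
  rw [LinearMap.range_coprod, Submodule.range_subtype, Submodule.range_subtype]

/-- The sum of the classes of finitely many independent submodules is at most the class of the
whole module. -/
theorem V.exists_sum_add_eq {ι : Type v} (K : ι → Submodule Tᵐᵒᵖ P.carrier)
    (hK : ∀ i, (K i).FG) (s : Finset ι) (hs : s.SupIndep K) :
    ∃ (C : Submodule Tᵐᵒᵖ P.carrier) (hC : C.FG),
      ∑ i ∈ s, V.mk (P.ofFG hT (K i) (hK i)) + V.mk (P.ofFG hT C hC) = V.mk P := by
  classical
  suffices h : ∃ hfg : (s.sup K).FG,
      ∑ i ∈ s, V.mk (P.ofFG hT (K i) (hK i)) = V.mk (P.ofFG hT (s.sup K) hfg) by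
    obtain ⟨hfg, h⟩ := h
    obtain ⟨C, hC, -, h'⟩ := V.exists_isCompl hT P hfg
    exact ⟨C, hC, h ▸ h'⟩
  induction s using Finset.induction_on with
  | empty => exact ⟨Submodule.fg_bot, ((V.mk_ofFG_eq_zero_iff hT P _).2 rfl).symm⟩
  | insert i s hi ih =>
    obtain ⟨hfg, h⟩ := ih (hs.subset (Finset.subset_insert i s))
    have hd : Disjoint (K i) (s.sup K) :=
      hs (Finset.subset_insert i s) (Finset.mem_insert_self i s) hi
    have hsup : (insert i s).sup K = K i ⊔ s.sup K := Finset.sup_insert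
    refine ⟨hsup ▸ (hK i).sup hfg, ?_⟩
    rw [Finset.sum_insert hi, h, V.mk_ofFG_add_mk_ofFG hT P (hK i) hfg hd]
    congr 2
    exact hsup.symm

end Classes

/-! ### Endomorphisms shifted by scalars -/

theorem supIndep_ker_sub_smul {F : Type v} {S : Type u} {P : Type w} [Field F] [Ring S]
    [Algebra F S] [AddCommGroup P] [Module S P] [Module F P] [IsScalarTower F S P]
    [SMulCommClass S F P] (f : P →ₗ[S] P) (s : Finset F) :
    s.SupIndep fun c => LinearMap.ker (f - c • LinearMap.id) := by
  classical
  have hind := (Module.End.eigenspaces_iSupIndep (f.restrictScalars F)).supIndep' s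
  have hmem : ∀ (c : F) (x : P), x ∈ LinearMap.ker (f - c • LinearMap.id) ↔
      x ∈ Module.End.eigenspace (f.restrictScalars F) c := by
    intro c x
    simp [sub_eq_zero]
  have hsup : ∀ (t : Finset F) (x : P),
      x ∈ t.sup (fun c => LinearMap.ker (f - c • LinearMap.id)) →
        x ∈ t.sup (Module.End.eigenspace (f.restrictScalars F)) := by
    intro t
    induction t using Finset.induction_on with
    | empty => intro x hx; simpa using hx
    | insert c t hc ih =>
      intro x hx
      rw [Finset.sup_insert] at hx ⊢
      obtain ⟨y, hy, z, hz, rfl⟩ := Submodule.mem_sup.1 hx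
      exact Submodule.add_mem_sup ((hmem c y).1 hy) (ih z hz)
  intro t ht c hc hct
  rw [Submodule.disjoint_def]
  intro x hx hx'
  exact Submodule.disjoint_def.1 (hind ht hc hct) x ((hmem c x).1 hx) (hsup t x hx')

section Countable

variable {F : Type v} [Field F] {T : Type u} [Ring T] [Algebra F T]
  (hT : IsVonNeumannRegular T) (N : AddSubmonoid (V T)) (hN : ∀ x y : V T, x + y ∈ N → x ∈ N)
  (g : ℕ → N →+ ℕ) (hg : ∀ x : N, (∀ n, g n x = 0) → x = 0)

include hT hN hg

/-- If the class of `P` lies in `N`, then an injective endomorphism of `P` is surjective: the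
class of its cokernel is killed by every `g n`. -/
theorem bijective_of_injective {P : FGProjModule T} (hP : V.mk P ∈ N)
    (f : P.carrier →ₗ[Tᵐᵒᵖ] P.carrier) (hf : Function.Injective f) : Function.Bijective f := by
  have hfg : (LinearMap.range f).FG := Submodule.fg_range f
  obtain ⟨C, hC, hcompl, h⟩ := V.exists_isCompl hT P hfg
  have hr : V.mk (P.ofFG hT _ hfg) = V.mk P := V.mk_eq_mk.2 ⟨(LinearEquiv.ofInjective f hf).symm⟩
  rw [hr] at h
  have hCN : V.mk (P.ofFG hT C hC) ∈ N := hN _ (V.mk P) (by rwa [add_comm, h])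
  have hsum : (⟨V.mk P, hP⟩ : N) + ⟨_, hCN⟩ = ⟨V.mk P, hP⟩ := Subtype.ext h
  have hzero : (⟨_, hCN⟩ : N) = 0 := hg _ fun n => by
    have := congrArg (g n) hsum
    rw [map_add] at this
    omega
  have hbot : C = ⊥ := (V.mk_ofFG_eq_zero_iff hT P hC).1 (congrArg Subtype.val hzero)
  refine ⟨hf, LinearMap.range_eq_top.1 ?_⟩
  simpa [hbot] using hcompl.sup_eq_top

/-- The eigenspaces of `f` are independent, so at most `g n [P]` of them have a class that is not
killed by `g n`. -/
theorem countable_setOf_not_bijective {P : FGProjModule T} [Module F P.carrier]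
    [IsScalarTower F Tᵐᵒᵖ P.carrier] [SMulCommClass Tᵐᵒᵖ F P.carrier] (hP : V.mk P ∈ N)
    (f : P.carrier →ₗ[Tᵐᵒᵖ] P.carrier) :
    {c : F | ¬ Function.Bijective
      (f - c • LinearMap.id : P.carrier →ₗ[Tᵐᵒᵖ] P.carrier)}.Countable := by
  let K : F → Submodule Tᵐᵒᵖ P.carrier := fun c => LinearMap.ker (f - c • LinearMap.id)
  have hK : ∀ c, (K c).FG := fun c =>
    fg_ker hT.mulOpposite (f - c • LinearMap.id)
  have hle (s : Finset F) := V.exists_sum_add_eq hT P K hK s (supIndep_ker_sub_smul f s)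
  have hKN : ∀ c, V.mk (P.ofFG hT (K c) (hK c)) ∈ N := by
    intro c
    obtain ⟨C, hC, h⟩ := hle {c}
    rw [Finset.sum_singleton] at h
    exact hN _ _ (h ▸ hP)
  let m : F → N := fun c => ⟨_, hKN c⟩
  have hbound : ∀ (n : ℕ) (s : Finset F), ∑ c ∈ s, g n (m c) ≤ g n ⟨_, hP⟩ := by
    intro n s
    obtain ⟨C, hC, h⟩ := hle s
    have hCN : V.mk (P.ofFG hT C hC) ∈ N := hN _ _ (by rw [add_comm, h]; exact hP)
    have hsum : ∑ c ∈ s, m c + ⟨_, hCN⟩ = ⟨V.mk P, hP⟩ := Subtype.ext (by simpa [m] using h)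
    rw [← hsum, map_add, map_sum]
    exact Nat.le_add_right _ _
  have hfin : ∀ n, {c | g n (m c) ≠ 0}.Finite := by
    intro n
    by_contra hinf
    obtain ⟨s, hs, hcard⟩ := Set.Infinite.exists_subset_card_eq hinf (g n ⟨_, hP⟩ + 1)
    have h := (Finset.card_nsmul_le_sum s (fun c => g n (m c)) 1
      fun c hc => Nat.one_le_iff_ne_zero.2 (hs hc)).trans (hbound n s)
    rw [hcard, smul_eq_mul, mul_one] at h
    omega
  refine (Set.countable_iUnion fun n => (hfin n).countable).mono fun c hc => ?_
  by_contra hcn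
  refine hc (bijective_of_injective hT N hN g hg hP _ (LinearMap.ker_eq_bot.1 ?_))
  refine (V.mk_ofFG_eq_zero_iff hT P (hK c)).1 (congrArg Subtype.val (hg (m c) fun n => ?_))
  by_contra hn
  exact hcn (Set.mem_iUnion.2 ⟨n, hn⟩)

end Countable

/-! ### Cancellation -/

/-- An isomorphism that carries the first summand identically to the first summand induces an
isomorphism of the complementary summands. -/
theorem nonempty_equiv_of_prod_equiv {S A B C : Type*} [Ring S] [AddCommGroup A] [Module S A]
    [AddCommGroup B] [Module S B] [AddCommGroup C] [Module S C] (E : (A × B) ≃ₗ[S] (A × C))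
    (hE : ∀ a, E (a, 0) = (a, 0)) : Nonempty (B ≃ₗ[S] C) := by
  have hE' : ∀ a, E.symm (a, 0) = (a, 0) := fun a => by
    rw [LinearEquiv.symm_apply_eq, hE]
  refine ⟨LinearEquiv.ofLinearMap
    (LinearMap.snd S A C ∘ₗ E.toLinearMap ∘ₗ LinearMap.inr S A B)
    (LinearMap.snd S A B ∘ₗ E.symm.toLinearMap ∘ₗ LinearMap.inr S A C) ?_ ?_⟩
  · ext c
    have h : ((0, (E.symm (0, c)).2) : A × B) = E.symm (0, c) - ((E.symm (0, c)).1, 0) := by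
      ext <;> simp
    simp [h, hE]
  · ext b
    have h : ((0, (E (0, b)).2) : A × C) = E (0, b) - ((E (0, b)).1, 0) := by
      ext <;> simp
    simp [h, hE']

/-- The scalar trick: `f` and `x` are mutually inverse isomorphisms between `A` and its second
copy `e⁻¹ A` inside `A × B`. For a scalar `c ≠ 0` with `f - c` and `x - c⁻¹` both invertible, the
automorphism `(1 - c x)⁻¹ (f - c)` of `A × B` agrees with `f` on `A`. -/
theorem nonempty_equiv_of_bijective {F S A B C : Type*} [Field F] [Ring S] [AddCommGroup A]
    [Module S A] [AddCommGroup B] [Module S B] [AddCommGroup C] [Module S C]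
    [Module F (A × B)] [SMulCommClass S F (A × B)]
    (e : (A × B) ≃ₗ[S] (A × C)) {c : F} (hc : c ≠ 0)
    (hf : Function.Bijective (e.symm.toLinearMap ∘ₗ LinearMap.inl S A C ∘ₗ LinearMap.fst S A B -
      c • LinearMap.id : A × B →ₗ[S] A × B))
    (hx : Function.Bijective (LinearMap.inl S A B ∘ₗ LinearMap.fst S A C ∘ₗ e.toLinearMap -
      c⁻¹ • LinearMap.id : A × B →ₗ[S] A × B)) : Nonempty (B ≃ₗ[S] C) := by
  let h := LinearEquiv.ofBijective _ hf
  let k := LinearEquiv.ofBijective _ hx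
  have hh : ∀ a, h (a, 0) = e.symm (a, 0) - c • (a, 0) := fun a => by simp [h]
  have hk : ∀ a, k (e.symm (a, 0)) = (a, 0) - c⁻¹ • e.symm (a, 0) := fun a => by simp [k]
  have := SMulCommClass.symm S F (A × B)
  -- `(1 - c x)⁻¹ (f - c)` is `k⁻¹ d h`, where `d` is the scalar `-c⁻¹`.
  let d := DistribMulAction.toLinearEquiv S (A × B) (Units.mk0 (-c⁻¹) (by simpa using hc))
  have hd : ∀ p, d p = -c⁻¹ • p := fun p => rfl
  refine nonempty_equiv_of_prod_equiv (h ≪≫ₗ d ≪≫ₗ k.symm ≪≫ₗ e) fun a => ?_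
  have key : d (h (a, 0)) = k (e.symm (a, 0)) := by
    rw [hd, hh, hk, smul_sub, smul_smul, neg_mul, inv_mul_cancel₀ hc, neg_one_smul, neg_smul]
    abel
  rw [LinearEquiv.trans_apply, LinearEquiv.trans_apply, LinearEquiv.trans_apply, key,
    k.symm_apply_apply, e.apply_symm_apply]

/-- A lower set `N` in `V T`, for a regular algebra `T` over an uncountable field, is cancellative
as soon as countably many homomorphisms to `ℕ` together detect its nonzero elements. -/
theorem isCancelAdd_of_faithful {F : Type v} [Field F] [Uncountable F] {T : Type u} [Ring T]
    [Algebra F T] (hT : IsVonNeumannRegular T) (N : AddSubmonoid (V T))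
    (hN : ∀ x y : V T, x + y ∈ N → x ∈ N) (g : ℕ → N →+ ℕ)
    (hg : ∀ x : N, (∀ n, g n x = 0) → x = 0) : IsCancelAdd N := by
  suffices h : IsLeftCancelAdd N from AddCommMagma.IsLeftCancelAdd.toIsCancelAdd N
  refine ⟨?_⟩
  rintro ⟨⟨A⟩, hA⟩ ⟨⟨B⟩, hB⟩ ⟨⟨C⟩, hC⟩ habc
  obtain ⟨e⟩ : Nonempty ((A.carrier × B.carrier) ≃ₗ[Tᵐᵒᵖ] (A.carrier × C.carrier)) :=
    V.mk_eq_mk.1 (congrArg Subtype.val habc)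
  refine Subtype.ext (V.mk_eq_mk.2 ?_)
  have hP : V.mk (A.directSum B) ∈ N := N.add_mem hA hB
  -- `F` acts on `A × B` through the centre of `Tᵐᵒᵖ`; the instances are repeated for the carrier
  -- of the direct sum, which is the same type only after unfolding.
  let : Module F (A.carrier × B.carrier) := Module.compHom _ (algebraMap F Tᵐᵒᵖ)
  have : IsScalarTower F Tᵐᵒᵖ (A.carrier × B.carrier) :=
    ⟨fun c s x => by
      rw [Algebra.smul_def, mul_smul]
      rfl⟩
  have : SMulCommClass Tᵐᵒᵖ F (A.carrier × B.carrier) := IsScalarTower.to_smulCommClass'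
  let : Module F (A.directSum B).carrier := ‹Module F (A.carrier × B.carrier)›
  have : IsScalarTower F Tᵐᵒᵖ (A.directSum B).carrier :=
    ‹IsScalarTower F Tᵐᵒᵖ (A.carrier × B.carrier)›
  have : SMulCommClass Tᵐᵒᵖ F (A.directSum B).carrier :=
    ‹SMulCommClass Tᵐᵒᵖ F (A.carrier × B.carrier)›
  have hf := countable_setOf_not_bijective (F := F) hT N hN g hg hP
    (e.symm.toLinearMap ∘ₗ LinearMap.inl _ _ _ ∘ₗ LinearMap.fst Tᵐᵒᵖ A.carrier B.carrier)
  have hx := countable_setOf_not_bijective (F := F) hT N hN g hg hP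
    (LinearMap.inl Tᵐᵒᵖ A.carrier B.carrier ∘ₗ LinearMap.fst _ _ _ ∘ₗ e.toLinearMap)
  have hbad := ((Set.countable_singleton (0 : F)).union hf).union
    (hx.preimage_of_injOn (f := fun c : F => c⁻¹) inv_injective.injOn)
  obtain ⟨c, hc⟩ := (Set.ne_univ_iff_exists_notMem _).1 fun h =>
    Set.not_countable_univ (h.subst (motive := Set.Countable) hbad)
  simp only [Set.mem_union, Set.mem_singleton_iff, Set.mem_ofPred_eq, Set.mem_preimage, not_or,
    not_not] at hc
  exact nonempty_equiv_of_bijective e hc.1.1 hc.1.2 hc.2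

theorem isCancelAdd_of_addEquiv {F : Type v} [Field F] [Uncountable F] {T : Type u} [Ring T]
    [Algebra F T] (hT : IsVonNeumannRegular T) (N : AddSubmonoid (V T))
    (hN : ∀ x y : V T, x + y ∈ N → x ∈ N) {M : Type w} [AddCommMonoid M] (g : ℕ → M →+ ℕ)
    (hg : ∀ x : M, (∀ n, g n x = 0) → x = 0) (ψ : N ≃+ M) : IsCancelAdd M := by
  have := isCancelAdd_of_faithful (F := F) hT N hN (fun n => (g n).comp ψ.toAddMonoidHom)
    fun x hx => (map_eq_zero_iff ψ ψ.injective).1 (hg _ hx)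
  exact ψ.symm.injective.isCancelAdd ψ.symm (map_add ψ.symm)

/-! ### Ideals and unitizations -/

theorem FGProjModule.EqMulIdeal.of_surjective {T : Type u} [Ring T] {J : TwoSidedIdeal T}
    {P Q : FGProjModule T} (hP : P.EqMulIdeal J) (f : P.carrier →ₗ[Tᵐᵒᵖ] Q.carrier)
    (hf : Function.Surjective f) : Q.EqMulIdeal J := by
  unfold FGProjModule.EqMulIdeal at hP ⊢
  rw [eq_top_iff, ← LinearMap.range_eq_top.2 hf, LinearMap.range_eq_map, ← hP,
    Submodule.map_span, Submodule.span_le]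
  rintro _ ⟨_, ⟨p, j, hj, rfl⟩, rfl⟩
  exact Submodule.subset_span ⟨f p, j, hj, map_smul f _ _⟩

theorem V.mem_ofIdeal_of_add_mem {T : Type u} [Ring T] {J : TwoSidedIdeal T} (x y : V T)
    (h : x + y ∈ V.ofIdeal J) : x ∈ V.ofIdeal J := by
  obtain ⟨P⟩ := x
  obtain ⟨Q⟩ := y
  obtain ⟨E, hE, h⟩ := h
  obtain ⟨f⟩ := V.mk_eq_mk.1 (show V.mk (P.directSum Q) = V.mk E from h)
  exact ⟨P, hE.of_surjective (LinearMap.fst Tᵐᵒᵖ P.carrier Q.carrier ∘ₗ f.symm.toLinearMap)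
    (Prod.fst_surjective.comp f.symm.surjective), rfl⟩

theorem IsVonNeumannRegular.unitization {F : Type v} {R : Type w} [Field F] [NonUnitalRing R]
    [Module F R] [IsScalarTower F R R] [SMulCommClass F R R] (hR : IsVonNeumannRegular R) :
    IsVonNeumannRegular (Unitization F R) := by
  intro a
  -- `a - a x a` lies in the ideal `R`, where regularity is available; `0⁻¹ = 0` covers `a ∈ R`.
  let x : Unitization F R := Unitization.inl a.fst⁻¹
  have hfst : (a - a * x * a).fst = 0 := by
    change a.fst - a.fst * a.fst⁻¹ * a.fst = 0
    rw [mul_inv_mul_cancel, sub_self]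
  obtain ⟨r, hr⟩ : ∃ r : R, a - a * x * a = r :=
    ⟨(a - a * x * a).snd, Unitization.ext (by simpa using hfst) (by simp)⟩
  obtain ⟨y, hy⟩ := hR r
  have hry : (a - a * x * a) * y * (a - a * x * a) = a - a * x * a := by
    rw [hr, ← Unitization.inr_mul, ← Unitization.inr_mul, hy]
  refine ⟨x + (1 - x * a) * y * (1 - a * x), ?_⟩
  calc a * (x + (1 - x * a) * y * (1 - a * x)) * a
      = a * x * a + (a - a * x * a) * y * (a - a * x * a) := by noncomm_ring
    _ = a := by rw [hry, add_sub_cancel]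

/-! ### Homomorphisms to the natural numbers -/

/-- A simplicial quotient `M / I`, followed by the sum of the coordinates, is a homomorphism to
`ℕ` that vanishes on no element outside `I`. -/
theorem exists_addMonoidHom_of_isSimplicialMonoid {M : Type u} [AddCommMonoid M]
    {I : AddSubmonoid M} (hI : IsOrderIdeal I) (h : IsSimplicialMonoid (IdealQuotient I)) :
    ∃ g : M →+ ℕ, ∀ x, g x = 0 → x ∈ I := by
  obtain ⟨k, -, ⟨φ⟩⟩ := h
  let σ : (Fin k → ℕ) →+ ℕ := ∑ i, Pi.evalAddMonoidHom (fun _ => ℕ) i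
  refine ⟨σ.comp (φ.toAddMonoidHom.comp (idealCon I).mk'), fun x hx => ?_⟩
  have hφ : φ ((idealCon I).mk' x) = 0 := by
    ext i
    have hx' : ∑ i, φ ((idealCon I).mk' x) i = 0 := by simpa [σ] using hx
    exact Finset.sum_eq_zero_iff.1 hx' i (Finset.mem_univ i)
  have hmk : (x : (idealCon I).Quotient) = ((0 : M) : (idealCon I).Quotient) :=
    (map_eq_zero_iff φ φ.injective).1 hφ
  obtain ⟨a, -, b, hb, hab⟩ := (AddCon.eq _).1 hmk
  exact hI x b ⟨a, by rw [hab, zero_add]⟩ hb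

theorem mainTheorem1
    (M : Type u) [AddCommMonoid M] (hconical : IsConical M) (hrefinement : IsRefinementMonoid M)
    (e : M) (he : IsOrderUnit e)
    (I : ℕ → AddSubmonoid M) (hideal : ∀ n, IsOrderIdeal (I n))
    (hinter : ⨅ n, I n = ⊥)
    (hsimplicial : ∀ n, IsSimplicialMonoid (IdealQuotient (I n)))
    (hnoncancel : ¬ IsCancelAdd M)
    (F : Type v) [Field F] [Uncountable F] :
    (∀ (R : Type w) [Ring R] [Algebra F R],
      IsVonNeumannRegular R → IsEmpty (V R ≃+ M)) ∧
    (∀ (R : Type w) [NonUnitalRing R] [Module F R] [IsScalarTower F R R] [SMulCommClass F R R],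
      IsVonNeumannRegular R → IsEmpty (nonunitalV F R ≃+ M)) := by
  choose g hg using fun n => exists_addMonoidHom_of_isSimplicialMonoid (hideal n) (hsimplicial n)
  have hfaithful : ∀ x : M, (∀ n, g n x = 0) → x = 0 := by
    intro x hx
    have : x ∈ ⨅ n, I n := AddSubmonoid.mem_iInf.2 fun n => hg n x (hx n)
    rwa [hinter] at this
  refine ⟨fun R _ _ hR => ⟨fun ψ => hnoncancel ?_⟩, fun R _ _ _ _ hR => ⟨fun ψ => hnoncancel ?_⟩⟩
  · exact isCancelAdd_of_addEquiv (F := F) hR ⊤ (fun _ _ _ => trivial) g hfaithful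
      (AddSubmonoid.topEquiv.trans ψ)
  · exact isCancelAdd_of_addEquiv (F := F) hR.unitization _ V.mem_ofIdeal_of_add_mem g hfaithful ψ
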